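/- Let $\mathsf{DL}$ be the category of bounded distributive lattices and bounded lattice homomorphisms, and $\mathsf{PS}$ the category of Priestley spaces and continuous order-preserving maps. Let $P:\mathsf{DL}\to\mathsf{PS}$ be the contravariant functor sending $L$ to the set of its prime filters, ordered by inclusion and with the topology generated by the sets $a^+=\{x\mid a\in x\}$ and $a^-=\{x\mid a\notin x\}$ ($a\in L$), and sending $f$ to $f^{-1}$; let $CU:\mathsf{PS}\to\mathsf{DL}$ be the contravariant functor sending $X$ to its lattice of clopen upsets and $g$ to $g^{-1}$; and for a Priestley space $X$ let $\eta_X:X\to P(CU(X))$, $\eta_X(x)=\{U\mid x\in U\}$. Let $\mathsf{DL}^{\Diamond\Box}$ be the category of bounded distributive lattices whose morphisms $L\to M$ are the pairs $(f,g)$ of functions such that $f$ preserves finite joins, $g$ preserves finite meets, $g(a\vee b)\le g(a)\vee f(b)$ and $g(a)\wedge f(b)\le f(a\wedge b)$. Let $\mathcal R:\mathsf{DL}\to\mathsf{DL}^{\Diamond\Box}$ be the identity on objects with $\mathcal R(f)=(f,f)$. Its left adjoint $\mathcal L$ sends $L$ to the bounded distributive lattice $L^{\Diamond\Box}$ freely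 generated by symbols $\Diamond_a,\Box_a$ ($a\in L$) modulo the relations $\Diamond_0=0$, $\Diamond_a\vee\Diamond_b=\Diamond_{a\vee b}$, $\Box_1=1$, $\Box_a\wedge\Box_b=\Box_{a\wedge b}$, $\Box_{a\vee b}\le\Box_a\vee\Diamond_b$, $\Box_a\wedge\Diamond_b\le\Diamond_{a\wedge b}$, and it sends $(f,g)$ to the homomorphism with $\Diamond_a\mapsto\Diamond_{f(a)}$, $\Box_a\mapsto\Box_{g(a)}$. Put $\mathcal K=\mathcal L\circ\mathcal R$. Let $\mathcal C:\mathsf{PS}\to\mathsf{PS}$ be the endofunctor sending $X$ to the set of its convex closed subsets (including $\varnothing$), ordered by $A\sqsubseteq B$ iff $A\subseteq{\downarrow}B$ and $B\subseteq{\uparrow}A$, with the topology generated by the sets $\Box_U,\Box_{X\setminus U},\Diamond_U,\Diamond_{X\setminus U}$ for $U$ a clopen upset of $X$, where $\Box_S=\{A\mid A\cap S=\varnothing\}$ and $\Diamond_S=\{A\mid A\cap S\ne\varnothing\}$; and sending $f$ to $A\mapsto{\downarrow}f(A)\cap{\uparrow}f(A)$. **Theorem.** There is a natural isomorphism $\varepsilon:\mathcal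 K\to CU\circ\mathcal C\circ P$ such that $\varepsilon_L(\Box_a)=\Box_{a^-}$ and $\varepsilon_L(\Diamond_a)=\Diamond_{a^+}$ for every bounded distributive lattice $L$ and every $a\in L$. Moreover, 1. $P\circ\mathcal K\simeq\mathcal C\circ P$, by a natural isomorphism $\psi:P\circ\mathcal K\to\mathcal C\circ P$ with $\psi_L^{-1}=P(\varepsilon_L)\circ\eta_{\mathcal C(P(L))}$ for every $L$; 2. $\mathcal K\circ CU\simeq CU\circ\mathcal C$, by a natural isomorphism $\varphi:\mathcal K\circ CU\to CU\circ\mathcal C$ with $\varphi_X=CU(\mathcal C(\eta_X))\circ\varepsilon_{CU(X)}$ for every Priestley space $X$. -/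

import Mathlib

open CategoryTheory

set_option linter.unusedSectionVars false

universe u v

namespace PriestleyDuality

/-! ### The category of Priestley spaces -/

/-- A Priestley space: a compact ordered space such that `x ≰ y` is always witnessed by a clopen
upset containing `x` and missing `y`. -/
structure PS : Type (u + 1) where
  carrier : Type u
  [topology : TopologicalSpace carrier]
  [order : PartialOrder carrier]
  [compact : CompactSpace carrier]
  [priestley : PriestleySpace carrier]

namespace PS

instance : CoeSort PS.{u} (Type u) := ⟨PS.carrier⟩

attribute [instance] PS.topology PS.order PS.compact PS.priestley

/-- Morphisms of Priestley spaces: continuous order-preserving maps. -/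
@[ext]
structure Hom (X Y : PS.{u}) : Type u where
  hom' : X →Co Y

instance : Category PS.{u} where
  Hom X Y := Hom X Y
  id X := ⟨ContinuousOrderHom.id X⟩
  comp f g := ⟨g.hom'.comp f.hom'⟩

instance : ConcreteCategory PS.{u} (fun X Y => X →Co Y) where
  hom := Hom.hom'
  ofHom := Hom.mk

theorem hom_ext {X Y : PS.{u}} {f g : X ⟶ Y} (h : ∀ x : X, f x = g x) : f = g :=
  ConcreteCategory.hom_ext _ _ h

end PS

/-! ### The functor `P` : prime filters -/

section PrimeFilter

variable {L : Type u} [DistribLattice L] [BoundedOrder L]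

variable (L) in
/-- The prime filters of `L`. -/
def PrimeFilter : Type u := {F : Order.PFilter L // F.IsPrime}

namespace PrimeFilter

instance : SetLike (PrimeFilter L) L where
  coe F := (F.1 : Set L)
  coe_injective := fun _ _ h => Subtype.ext (SetLike.coe_injective h)

/-- Prime filters are ordered by inclusion. -/
instance : PartialOrder (PrimeFilter L) := PartialOrder.ofSetLike (PrimeFilter L) L

theorem le_def {F G : PrimeFilter L} : F ≤ G ↔ ∀ a, a ∈ F → a ∈ G := Iff.rfl

theorem mem_of_le {F : PrimeFilter L} {a b : L} (h : a ≤ b) (ha : a ∈ F) : b ∈ F :=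
  Order.PFilter.mem_of_le (F := F.1) h ha

theorem top_mem (F : PrimeFilter L) : (⊤ : L) ∈ F := Order.PFilter.top_mem (F := F.1)

theorem inf_mem_iff (F : PrimeFilter L) {a b : L} : a ⊓ b ∈ F ↔ a ∈ F ∧ b ∈ F :=
  Order.PFilter.inf_mem_iff (F := F.1)

theorem bot_notMem (F : PrimeFilter L) : (⊥ : L) ∉ F := by
  have h := F.2.compl_ideal
  obtain ⟨x, hx⟩ := h.Nonempty
  exact h.IsLowerSet bot_le hx

theorem sup_mem_iff (F : PrimeFilter L) {a b : L} : a ⊔ b ∈ F ↔ a ∈ F ∨ b ∈ F := by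
  constructor
  · intro hab
    by_contra hc
    push Not at hc
    have h := F.2.compl_ideal
    obtain ⟨z, hz, haz, hbz⟩ := h.Directed a hc.1 b hc.2
    exact hz (mem_of_le (F := F) (sup_le haz hbz) hab)
  · rintro (h | h)
    · exact mem_of_le le_sup_left h
    · exact mem_of_le le_sup_right h

/-- A prime filter from its elementary closure properties. -/
def ofSet (S : Set L) (up : ∀ a b : L, a ≤ b → a ∈ S → b ∈ S) (top : ⊤ ∈ S)
    (inf : ∀ a b : L, a ∈ S → b ∈ S → a ⊓ b ∈ S) (bot : ⊥ ∉ S)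
    (sup : ∀ a b : L, a ⊔ b ∈ S → a ∈ S ∨ b ∈ S) : PrimeFilter L :=
  ⟨(Order.IsPFilter.of_def (F := S) ⟨⊤, top⟩
      (fun a ha b hb => ⟨a ⊓ b, inf a b ha hb, inf_le_left, inf_le_right⟩)
      (fun {a b} h ha => up a b h ha)).toPFilter,
    ⟨{ IsLowerSet := fun a b hba ha hb => ha (up b a hba hb)
       Nonempty := ⟨⊥, bot⟩
       Directed := fun a ha b hb =>
        ⟨a ⊔ b, fun h => (sup a b h).elim ha hb, le_sup_left, le_sup_right⟩ }⟩⟩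

theorem mem_ofSet {S : Set L} {h₁ h₂ h₃ h₄ h₅} {a : L} :
    a ∈ ofSet S h₁ h₂ h₃ h₄ h₅ ↔ a ∈ S := Iff.rfl

/-- `a⁺`, the set of prime filters containing `a`. -/
def plus (a : L) : Set (PrimeFilter L) := {x | a ∈ x}

/-- `a⁻`, the set of prime filters not containing `a`. -/
def minus (a : L) : Set (PrimeFilter L) := {x | a ∉ x}

/-- The topology generated by the sets `a⁺` and `a⁻`. -/
instance : TopologicalSpace (PrimeFilter L) :=
  TopologicalSpace.generateFrom (Set.range plus ∪ Set.range minus)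

theorem compl_plus (a : L) : (plus a)ᶜ = minus a := rfl

theorem isOpen_plus (a : L) : IsOpen (plus a) :=
  TopologicalSpace.isOpen_generateFrom_of_mem (Or.inl ⟨a, rfl⟩)

theorem isOpen_minus (a : L) : IsOpen (minus a) :=
  TopologicalSpace.isOpen_generateFrom_of_mem (Or.inr ⟨a, rfl⟩)

theorem isClopen_plus (a : L) : IsClopen (plus a) :=
  ⟨⟨isOpen_minus a⟩, isOpen_plus a⟩

theorem isUpperSet_plus (a : L) : IsUpperSet (plus a) := fun _ _ h ha => h ha

/-- The prime filter theorem, for the ideal generated by `A` and the filter generated by `B`. -/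
theorem exists_separating {A B : Set L}
    (h : ∀ s t : Finset L, ↑s ⊆ A → ↑t ⊆ B → ¬ t.inf id ≤ s.sup id) :
    ∃ x : PrimeFilter L, (∀ a ∈ A, a ∉ x) ∧ ∀ b ∈ B, b ∈ x := by
  classical
  have hI : Order.IsIdeal {x : L | ∃ s : Finset L, ↑s ⊆ A ∧ x ≤ s.sup id} :=
    { IsLowerSet := by
        rintro x y hyx ⟨s, hs, hx⟩
        exact ⟨s, hs, hyx.trans hx⟩
      Nonempty := ⟨⊥, ∅, by simp, bot_le⟩
      Directed := by
        rintro x ⟨s, hs, hx⟩ y ⟨t, ht, hy⟩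
        refine ⟨x ⊔ y, ⟨s ∪ t, by simp [hs, ht], ?_⟩, le_sup_left, le_sup_right⟩
        rw [Finset.sup_union]
        exact sup_le_sup hx hy }
  have hF : Order.IsPFilter {x : L | ∃ t : Finset L, ↑t ⊆ B ∧ t.inf id ≤ x} := by
    refine Order.IsPFilter.of_def ⟨⊤, ∅, by simp, le_top⟩ ?_ ?_
    · rintro x ⟨s, hs, hx⟩ y ⟨t, ht, hy⟩
      refine ⟨x ⊓ y, ⟨s ∪ t, by simp [hs, ht], ?_⟩, inf_le_left, inf_le_right⟩
      rw [Finset.inf_union]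
      exact inf_le_inf hx hy
    · rintro x y hxy ⟨s, hs, hx⟩
      exact ⟨s, hs, hx.trans hxy⟩
  have hd : Disjoint (hF.toPFilter : Set L) (hI.toIdeal : Set L) := by
    rw [Set.disjoint_left]
    rintro x ⟨t, ht, hx⟩ ⟨s, hs, hx'⟩
    exact h s t hs ht (le_trans hx hx')
  obtain ⟨J, hJ, hIJ, hFJ⟩ := DistribLattice.prime_ideal_of_disjoint_filter_ideal hd
  refine ⟨ofSet (J : Set L)ᶜ (fun a b hab ha hb => ha (J.lower hab hb)) ?_ ?_ ?_ ?_, ?_, ?_⟩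
  · exact Set.disjoint_left.1 hFJ ⟨∅, by simp, le_top⟩
  · intro a b ha hb hab
    rcases hJ.mem_or_mem hab with h | h
    · exact ha h
    · exact hb h
  · exact fun h => h (J.bot_mem)
  · intro a b hab
    by_contra hc
    push Not at hc
    exact hab (Order.Ideal.sup_mem (Set.notMem_compl_iff.1 hc.1) (Set.notMem_compl_iff.1 hc.2))
  · intro a ha ha'
    exact ha' (hIJ ⟨{a}, by simpa using ha, by simp⟩)
  · intro b hb
    exact Set.disjoint_left.1 hFJ ⟨{b}, by simpa using hb, by simp⟩

instance : CompactSpace (PrimeFilter L) := by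
  classical
  refine compactSpace_generateFrom (S := Set.range plus ∪ Set.range minus) rfl ?_
  intro Q hQ hcov
  by_contra hfin
  push Not at hfin
  obtain ⟨x, hxA, hxB⟩ := exists_separating (L := L) (A := {a | plus a ∈ Q})
    (B := {b | minus b ∈ Q}) (by
      intro s t hs ht hle
      refine hfin (plus '' (s : Set L) ∪ minus '' (t : Set L)) ?_ ?_ ?_
      · rintro _ (⟨a, ha, rfl⟩ | ⟨a, ha, rfl⟩)
        · exact hs ha
        · exact ht ha
      · exact (s.finite_toSet.image _).union (t.finite_toSet.image _)
      · refine Set.eq_univ_of_forall fun y => ?_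
        by_contra hy
        have h1 : ∀ u : Finset L, (∀ a ∈ u, a ∈ y) → u.inf id ∈ y := by
          intro u
          induction u using Finset.induction_on with
          | empty => intro _; exact y.top_mem
          | insert a u ha ih =>
            intro h
            rw [Finset.inf_insert]
            exact y.inf_mem_iff.2 ⟨h a (by simp), ih fun b hb => h b (by simp [hb])⟩
        have h2 : ∀ u : Finset L, u.sup id ∈ y → ∃ a ∈ u, a ∈ y := by
          intro u
          induction u using Finset.induction_on with
          | empty => intro h; exact (y.bot_notMem h).elim
          | insert a u ha ih =>
            intro h
            rw [Finset.sup_insert] at h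
            rcases y.sup_mem_iff.1 h with h | h
            · exact ⟨a, by simp, h⟩
            · obtain ⟨b, hb, hb'⟩ := ih h
              exact ⟨b, by simp [hb], hb'⟩
        have h3 : t.inf id ∈ y := h1 t fun b hb => by
          by_contra hby
          exact hy ⟨minus b, Or.inr ⟨b, hb, rfl⟩, hby⟩
        obtain ⟨a, ha, hay⟩ := h2 s (mem_of_le hle h3)
        exact hy ⟨plus a, Or.inl ⟨a, ha, rfl⟩, hay⟩)
  obtain ⟨V, hV, hxV⟩ : x ∈ ⋃₀ Q := hcov ▸ Set.mem_univ x
  rcases hQ hV with ⟨a, rfl⟩ | ⟨a, rfl⟩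
  · exact hxA a hV hxV
  · exact hxV (hxB a hV)

instance : PriestleySpace (PrimeFilter L) where
  priestley {x y} h := by
    rw [le_def] at h
    push Not at h
    obtain ⟨a, hax, hay⟩ := h
    exact ⟨plus a, isClopen_plus a, isUpperSet_plus a, hax, hay⟩

/-- Inverse image of prime filters along a bounded lattice homomorphism. -/
def comap {M : Type u} [DistribLattice M] [BoundedOrder M] (f : BoundedLatticeHom L M) :
    PrimeFilter M →Co PrimeFilter L where
  toFun y := ofSet (f ⁻¹' (y : Set M))
    (fun _ _ hab ha => mem_of_le (F := y) (OrderHomClass.mono f hab) ha)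
    (by simpa using y.top_mem)
    (fun a b ha hb => by simpa using y.inf_mem_iff.2 ⟨ha, hb⟩)
    (by simpa using y.bot_notMem)
    (fun a b h => y.sup_mem_iff.1 (by simpa using h))
  monotone' _ _ h _ ha := h ha
  continuous_toFun := by
    refine continuous_generateFrom_iff.2 ?_
    rintro _ (⟨a, rfl⟩ | ⟨a, rfl⟩)
    · exact isOpen_plus (f a)
    · exact isOpen_minus (f a)

theorem mem_comap {M : Type u} [DistribLattice M] [BoundedOrder M] (f : BoundedLatticeHom L M)
    (y : PrimeFilter M) (a : L) : a ∈ comap f y ↔ f a ∈ y := Iff.rfl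

end PrimeFilter

end PrimeFilter

/-- The contravariant functor from bounded distributive lattices to Priestley spaces, taking `L` to
its space of prime filters and `f` to `f⁻¹`. -/
def P : BddDistLat.{u}ᵒᵖ ⥤ PS.{u} where
  obj L := { carrier := PrimeFilter L.unop }
  map f := ConcreteCategory.ofHom (PrimeFilter.comap f.unop.hom)
  map_id _ := PS.hom_ext fun _ => rfl
  map_comp _ _ := PS.hom_ext fun _ => rfl

/-! ### The functor `CU` : clopen upsets -/

section ClopenUpperSet

variable {X : Type u} [TopologicalSpace X] [PartialOrder X]

instance : DistribLattice (ClopenUpperSet X) where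
  le_sup_inf s t r := by
    change ((s : Set X) ∪ t) ∩ (s ∪ r) ⊆ s ∪ t ∩ r
    rw [Set.union_inter_distrib_left]

/-- Inverse image of clopen upsets along a continuous order-preserving map. -/
def clopenUpperSetComap {Y : Type u} [TopologicalSpace Y] [PartialOrder Y] (g : X →Co Y) :
    BoundedLatticeHom (ClopenUpperSet Y) (ClopenUpperSet X) where
  toFun U := ⟨⟨g ⁻¹' (U : Set Y), U.isClopen.preimage g.continuous_toFun⟩,
    U.upper.preimage g.monotone'⟩
  map_sup' _ _ := rfl
  map_inf' _ _ := rfl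
  map_top' := rfl
  map_bot' := rfl

end ClopenUpperSet

/-- The contravariant functor from Priestley spaces to bounded distributive lattices, taking `X` to
its lattice of clopen upsets and `g` to `g⁻¹`. -/
def CU : PS.{u}ᵒᵖ ⥤ BddDistLat.{u} where
  obj X := BddDistLat.of (ClopenUpperSet X.unop)
  map g := BddDistLat.ofHom (clopenUpperSetComap (ConcreteCategory.hom g.unop))
  map_id _ := BddDistLat.ext fun _ => rfl
  map_comp _ _ := BddDistLat.ext fun _ => rfl

/-- The canonical morphism `X ⟶ P (CU X)`, taking `x` to the set of clopen upsets containing `x`. -/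
def eta (X : PS.{u}) : X ⟶ P.obj (Opposite.op (CU.obj (Opposite.op X))) :=
  ConcreteCategory.ofHom (C := PS.{u}) (X := X) (Y := { carrier := PrimeFilter (ClopenUpperSet X) })
    { toFun := fun x => PrimeFilter.ofSet {U : ClopenUpperSet X | x ∈ U}
        (fun _ _ h hx => h hx) (Set.mem_univ x) (fun _ _ hU hV => ⟨hU, hV⟩) (fun h => h)
        (fun _ _ h => h)
      monotone' := fun _ _ hxy U hx => U.upper hxy hx
      continuous_toFun := by
        refine continuous_generateFrom_iff.2 ?_
        rintro _ (⟨U, rfl⟩ | ⟨U, rfl⟩)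
        · exact U.isClopen.isOpen
        · exact U.isClopen.compl.isOpen }

/-! ### The convex Vietoris functor -/

section ConvexClosed

/-- The convex closed subsets of an ordered space (the empty set included). -/
structure ConvexClosed (X : Type u) [TopologicalSpace X] [PartialOrder X] : Type u where
  carrier : Set X
  isClosed' : IsClosed carrier
  convex' : ∀ x ∈ carrier, ∀ y ∈ carrier, ∀ z, x ≤ z → z ≤ y → z ∈ carrier

namespace ConvexClosed

variable {X : Type u} [TopologicalSpace X] [PartialOrder X]

instance : SetLike (ConvexClosed X) X where
  coe := carrier
  coe_injective := fun A B h => by cases A; cases B; congr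

theorem isClosed (A : ConvexClosed X) : IsClosed (A : Set X) := A.isClosed'

theorem convex (A : ConvexClosed X) {x y z : X} (hx : x ∈ A) (hy : y ∈ A) (hxz : x ≤ z)
    (hzy : z ≤ y) : z ∈ A := A.convex' x hx y hy z hxz hzy

/-- The Egli-Milner order: `A ⊑ B` iff `A ⊆ ↓B` and `B ⊆ ↑A`. -/
instance : PartialOrder (ConvexClosed X) where
  le A B := (A : Set X) ⊆ lowerClosure (B : Set X) ∧ (B : Set X) ⊆ upperClosure (A : Set X)
  le_refl A := ⟨subset_lowerClosure, subset_upperClosure⟩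
  le_trans A B C h k :=
    ⟨h.1.trans (lowerClosure_min k.1 (lowerClosure _).lower),
      k.2.trans (upperClosure_min h.2 (upperClosure _).upper)⟩
  le_antisymm A B h k := by
    apply SetLike.coe_injective
    apply Set.Subset.antisymm
    · intro x hx
      obtain ⟨b, hb, hxb⟩ := h.1 hx
      obtain ⟨c, hc, hcx⟩ := k.2 hx
      exact B.convex hc hb hcx hxb
    · intro x hx
      obtain ⟨b, hb, hxb⟩ := k.1 hx
      obtain ⟨c, hc, hcx⟩ := h.2 hx
      exact A.convex hc hb hcx hxb

theorem le_def {A B : ConvexClosed X} :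
    A ≤ B ↔ (∀ x ∈ A, ∃ y ∈ B, x ≤ y) ∧ ∀ y ∈ B, ∃ x ∈ A, x ≤ y := Iff.rfl

/-- `□_U`, the set of all `C` that miss `U`. -/
def miss (U : Set X) : Set (ConvexClosed X) := {C | (C : Set X) ∩ U = ∅}

/-- `◇_U`, the set of all `C` that hit `U`. -/
def hit (U : Set X) : Set (ConvexClosed X) := {C | ((C : Set X) ∩ U).Nonempty}

theorem mem_hit {U : Set X} {C : ConvexClosed X} : C ∈ hit U ↔ ∃ x ∈ C, x ∈ U := Iff.rfl

theorem compl_hit (U : Set X) : (hit U)ᶜ = miss U := by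
  ext C
  exact Set.not_nonempty_iff_eq_empty

theorem mem_miss {U : Set X} {C : ConvexClosed X} : C ∈ miss U ↔ ∀ x ∈ C, x ∉ U := by
  rw [← compl_hit, Set.mem_compl_iff, mem_hit]
  push Not
  rfl

variable (X) in
/-- The subbasis of the weak hit-or-miss topology: all `□_U`, `□_{Uᶜ}`, `◇_U`, `◇_{Uᶜ}` where `U` is
a clopen upset. -/
def subbasis : Set (Set (ConvexClosed X)) :=
  {s | ∃ U : ClopenUpperSet X, s = miss (U : Set X) ∨ s = miss (U : Set X)ᶜ ∨
    s = hit (U : Set X) ∨ s = hit (U : Set X)ᶜ}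

/-- The weak hit-or-miss topology. -/
instance : TopologicalSpace (ConvexClosed X) := TopologicalSpace.generateFrom (subbasis X)

theorem isOpen_miss (U : ClopenUpperSet X) : IsOpen (miss (U : Set X)) :=
  TopologicalSpace.isOpen_generateFrom_of_mem ⟨U, Or.inl rfl⟩

theorem isOpen_miss_compl (U : ClopenUpperSet X) : IsOpen (miss (U : Set X)ᶜ) :=
  TopologicalSpace.isOpen_generateFrom_of_mem ⟨U, Or.inr (Or.inl rfl)⟩

theorem isOpen_hit (U : ClopenUpperSet X) : IsOpen (hit (U : Set X)) :=
  TopologicalSpace.isOpen_generateFrom_of_mem ⟨U, Or.inr (Or.inr (Or.inl rfl))⟩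

theorem isOpen_hit_compl (U : ClopenUpperSet X) : IsOpen (hit (U : Set X)ᶜ) :=
  TopologicalSpace.isOpen_generateFrom_of_mem ⟨U, Or.inr (Or.inr (Or.inr rfl))⟩

theorem isClopen_hit (U : ClopenUpperSet X) : IsClopen (hit (U : Set X)) :=
  ⟨⟨compl_hit (U : Set X) ▸ isOpen_miss U⟩, isOpen_hit U⟩

theorem isClopen_miss_compl (U : ClopenUpperSet X) : IsClopen (miss (U : Set X)ᶜ) :=
  ⟨⟨by rw [← compl_hit, compl_compl]; exact isOpen_hit_compl U⟩, isOpen_miss_compl U⟩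

theorem isUpperSet_hit (U : ClopenUpperSet X) : IsUpperSet (hit (U : Set X)) := by
  rintro A B h ⟨x, hx, hxU⟩
  obtain ⟨y, hy, hxy⟩ := h.1 hx
  exact ⟨y, hy, U.upper hxy hxU⟩

theorem isUpperSet_miss_compl (U : ClopenUpperSet X) : IsUpperSet (miss (U : Set X)ᶜ) := by
  intro A B h hA
  rw [mem_miss] at hA ⊢
  intro y hy hyU
  obtain ⟨x, hx, hxy⟩ := h.2 hy
  exact hA x hx fun hxU => hyU (U.upper hxy hxU)

instance [CompactSpace X] : CompactSpace (ConvexClosed X) := by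
  refine compactSpace_generateFrom (S := subbasis X) rfl ?_
  intro Q hQ hcov
  -- `T` is the union of all `V` with `◇_V` in the cover, `V` a clopen upset or downset.
  let 𝒱 : Set (Set X) :=
    {V | hit V ∈ Q ∧ ∃ U : ClopenUpperSet X, V = (U : Set X) ∨ V = (U : Set X)ᶜ}
  have hopen : ∀ V ∈ 𝒱, IsOpen V := by
    rintro V ⟨-, U, rfl | rfl⟩
    · exact U.isClopen.isOpen
    · exact U.isClopen.compl.isOpen
  let C : ConvexClosed X :=
    { carrier := (⋃₀ 𝒱)ᶜ
      isClosed' := (isOpen_sUnion hopen).isClosed_compl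
      convex' := by
        rintro x hx y hy z hxz hzy ⟨V, hV, hzV⟩
        obtain ⟨-, U, rfl | rfl⟩ := id hV
        · exact hy ⟨_, hV, U.upper hzy hzV⟩
        · exact hx ⟨_, hV, fun hxU => hzV (U.upper hxz hxU)⟩ }
  obtain ⟨s, hs, hCs⟩ : C ∈ ⋃₀ Q := hcov ▸ Set.mem_univ C
  have hcomp : ∀ K : Set X, IsClosed K → K ⊆ ⋃₀ 𝒱 → ∃ T ⊆ 𝒱, T.Finite ∧ K ⊆ ⋃₀ T := by
    intro K hK hsub
    rw [Set.sUnion_eq_biUnion] at hsub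
    obtain ⟨T, hT, hTf, hKT⟩ := hK.isCompact.elim_finite_subcover_image hopen hsub
    exact ⟨T, hT, hTf, by rwa [Set.sUnion_eq_biUnion]⟩
  have key : ∀ K : Set X, IsClosed K → miss K ∈ Q → C ∈ miss K →
      ∃ Q' ⊆ Q, Q'.Finite ∧ ⋃₀ Q' = Set.univ := by
    intro K hK hKQ hCK
    have hsub : K ⊆ ⋃₀ 𝒱 := fun x hx => by
      by_contra hxV
      exact mem_miss.1 hCK x hxV hx
    obtain ⟨T, hT𝒱, hTfin, hKT⟩ := hcomp K hK hsub
    refine ⟨insert (miss K) (hit '' T), ?_, (hTfin.image _).insert _, ?_⟩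
    · rintro _ (rfl | ⟨V, hV, rfl⟩)
      · exact hKQ
      · exact (hT𝒱 hV).1
    · refine Set.eq_univ_of_forall fun D => ?_
      by_cases hD : D ∈ miss K
      · exact ⟨_, Or.inl rfl, hD⟩
      · rw [← compl_hit, Set.notMem_compl_iff] at hD
        obtain ⟨x, hxD, hxK⟩ := hD
        obtain ⟨V, hV, hxV⟩ := hKT hxK
        exact ⟨_, Or.inr ⟨V, hV, rfl⟩, x, hxD, hxV⟩
  obtain ⟨U, rfl | rfl | rfl | rfl⟩ := hQ hs
  · exact key _ U.isClopen.isClosed hs hCs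
  · exact key _ U.isClopen.compl.isClosed hs hCs
  · obtain ⟨x, hx, hxU⟩ := hCs
    exact (hx ⟨_, ⟨hs, U, Or.inl rfl⟩, hxU⟩).elim
  · obtain ⟨x, hx, hxU⟩ := hCs
    exact (hx ⟨_, ⟨hs, U, Or.inr rfl⟩, hxU⟩).elim

section Separation

variable [CompactSpace X] [PriestleySpace X]

/-- A point outside `↓K`, `K` compact, is separated from `K` by a clopen upset. -/
theorem exists_clopen_of_notMem_lowerClosure {K : Set X} (hK : IsCompact K) {x : X}
    (hx : x ∉ lowerClosure K) : ∃ U : ClopenUpperSet X, x ∈ U ∧ ∀ y ∈ K, y ∉ U := by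
  classical
  have h : ∀ y : K, ∃ U : ClopenUpperSet X, x ∈ U ∧ y.1 ∉ U := by
    intro y
    obtain ⟨U, hU, hU', hxU, hyU⟩ :=
      exists_isClopen_upper_of_not_le (x := x) (y := y.1) fun hle => hx ⟨y.1, y.2, hle⟩
    exact ⟨⟨⟨U, hU⟩, hU'⟩, hxU, hyU⟩
  choose U hxU hyU using h
  obtain ⟨t, ht⟩ := hK.elim_finite_subcover (fun y : K => ((U y : Set X))ᶜ)
    (fun y => (U y).isClopen.compl.isOpen) fun y hy => Set.mem_iUnion.2 ⟨⟨y, hy⟩, hyU ⟨y, hy⟩⟩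
  refine ⟨t.inf U, ?_, ?_⟩
  · have : ∀ s : Finset K, x ∈ s.inf U := by
      intro s
      induction s using Finset.induction_on with
      | empty => exact Set.mem_univ x
      | insert a s ha ih => rw [Finset.inf_insert]; exact ⟨hxU a, ih⟩
    exact this t
  · intro y hy hyt
    obtain ⟨i, hi⟩ := Set.mem_iUnion.1 (ht hy)
    obtain ⟨hit, hyi⟩ := Set.mem_iUnion.1 hi
    exact hyi ((Finset.inf_le hit : t.inf U ≤ U i) hyt)

/-- A point outside `↑K`, `K` compact, is separated from `K` by a clopen upset. -/
theorem exists_clopen_of_notMem_upperClosure {K : Set X} (hK : IsCompact K) {x : X}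
    (hx : x ∉ upperClosure K) : ∃ U : ClopenUpperSet X, x ∉ U ∧ ∀ y ∈ K, y ∈ U := by
  classical
  have h : ∀ y : K, ∃ U : ClopenUpperSet X, x ∉ U ∧ y.1 ∈ U := by
    intro y
    obtain ⟨U, hU, hU', hxU, hyU⟩ :=
      exists_isClopen_upper_of_not_le (x := y.1) (y := x) fun hle => hx ⟨y.1, y.2, hle⟩
    exact ⟨⟨⟨U, hU⟩, hU'⟩, hyU, hxU⟩
  choose U hxU hyU using h
  obtain ⟨t, ht⟩ := hK.elim_finite_subcover (fun y : K => (U y : Set X))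
    (fun y => (U y).isClopen.isOpen) fun y hy => Set.mem_iUnion.2 ⟨⟨y, hy⟩, hyU ⟨y, hy⟩⟩
  refine ⟨t.sup U, ?_, ?_⟩
  · have : ∀ s : Finset K, x ∉ s.sup U := by
      intro s
      induction s using Finset.induction_on with
      | empty => exact fun h => h
      | insert a s ha ih => rw [Finset.sup_insert]; exact fun h => h.elim (hxU a) ih
    exact this t
  · intro y hy
    obtain ⟨i, hi⟩ := Set.mem_iUnion.1 (ht hy)
    obtain ⟨hit, hyi⟩ := Set.mem_iUnion.1 hi
    exact (Finset.le_sup hit : U i ≤ t.sup U) hyi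

theorem isClosed_lowerClosure {K : Set X} (hK : IsCompact K) :
    IsClosed (lowerClosure K : Set X) := by
  refine isOpen_compl_iff.1 (isOpen_iff_forall_mem_open.2 fun x hx => ?_)
  obtain ⟨U, hxU, hU⟩ := exists_clopen_of_notMem_lowerClosure hK hx
  exact ⟨U, fun z hz ⟨y, hy, hzy⟩ => hU y hy (U.upper hzy hz), U.isClopen.isOpen, hxU⟩

theorem isClosed_upperClosure {K : Set X} (hK : IsCompact K) :
    IsClosed (upperClosure K : Set X) := by
  refine isOpen_compl_iff.1 (isOpen_iff_forall_mem_open.2 fun x hx => ?_)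
  obtain ⟨U, hxU, hU⟩ := exists_clopen_of_notMem_upperClosure hK hx
  exact ⟨(U : Set X)ᶜ, fun z hz ⟨y, hy, hyz⟩ => hz (U.upper hyz (hU y hy)),
    U.isClopen.compl.isOpen, hxU⟩

instance : PriestleySpace (ConvexClosed X) where
  priestley {A B} h := by
    by_cases h1 : (A : Set X) ⊆ lowerClosure (B : Set X)
    · have h2 : ¬ (B : Set X) ⊆ upperClosure (A : Set X) := fun h2 => h ⟨h1, h2⟩
      obtain ⟨x, hxB, hx⟩ := Set.not_subset.1 h2
      obtain ⟨U, hxU, hU⟩ := exists_clopen_of_notMem_upperClosure A.isClosed.isCompact hx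
      exact ⟨miss (U : Set X)ᶜ, isClopen_miss_compl U, isUpperSet_miss_compl U,
        mem_miss.2 fun y hy hyU => hyU (hU y hy), fun hB => mem_miss.1 hB x hxB hxU⟩
    · obtain ⟨x, hxA, hx⟩ := Set.not_subset.1 h1
      obtain ⟨U, hxU, hU⟩ := exists_clopen_of_notMem_lowerClosure B.isClosed.isCompact hx
      exact ⟨hit (U : Set X), isClopen_hit U, isUpperSet_hit U, ⟨x, hxA, hxU⟩,
        fun ⟨y, hy, hyU⟩ => hU y hy hyU⟩

/-- The convex hull `A* = ↓A ∩ ↑A` of a closed set `A`. -/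
def hull (A : Set X) (hA : IsClosed A) : ConvexClosed X where
  carrier := (lowerClosure A : Set X) ∩ upperClosure A
  isClosed' := (isClosed_lowerClosure hA.isCompact).inter (isClosed_upperClosure hA.isCompact)
  convex' := fun _ hx _ hy _ hxz hzy =>
    ⟨(lowerClosure A).lower hzy hy.1, (upperClosure A).upper hxz hx.2⟩

theorem mem_hull {A : Set X} {hA : IsClosed A} {x : X} :
    x ∈ hull A hA ↔ (∃ a ∈ A, x ≤ a) ∧ ∃ a ∈ A, a ≤ x := Iff.rfl

theorem subset_hull {A : Set X} {hA : IsClosed A} {x : X} (hx : x ∈ A) : x ∈ hull A hA :=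
  ⟨⟨x, hx, le_rfl⟩, ⟨x, hx, le_rfl⟩⟩

variable {Y : Type u} [TopologicalSpace Y] [PartialOrder Y] [CompactSpace Y] [PriestleySpace Y]

/-- The map `C ↦ f(C)*` on convex closed sets. -/
def mapFun (f : X →Co Y) (C : ConvexClosed X) : ConvexClosed Y :=
  hull (f '' (C : Set X)) (C.isClosed.isCompact.image f.continuous_toFun).isClosed

theorem mem_mapFun {f : X →Co Y} {C : ConvexClosed X} {y : Y} :
    y ∈ mapFun f C ↔ (∃ x ∈ C, y ≤ f x) ∧ ∃ x ∈ C, f x ≤ y := by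
  simp only [mapFun, mem_hull, Set.exists_mem_image]
  rfl

theorem mapFun_preimage_hit (f : X →Co Y) {V : Set Y} (hV : IsUpperSet V ∨ IsLowerSet V) :
    mapFun f ⁻¹' hit V = hit (f ⁻¹' V) := by
  ext C
  constructor
  · rintro ⟨y, hy, hyV⟩
    obtain ⟨⟨a, ha, hya⟩, b, hb, hby⟩ := mem_mapFun.1 hy
    rcases hV with hV | hV
    · exact ⟨a, ha, hV hya hyV⟩
    · exact ⟨b, hb, hV hby hyV⟩
  · rintro ⟨x, hx, hxV⟩
    exact ⟨f x, subset_hull ⟨x, hx, rfl⟩, hxV⟩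

theorem mapFun_preimage_miss (f : X →Co Y) {V : Set Y} (hV : IsUpperSet V ∨ IsLowerSet V) :
    mapFun f ⁻¹' miss V = miss (f ⁻¹' V) := by
  rw [← compl_hit, ← compl_hit, Set.preimage_compl, mapFun_preimage_hit f hV]

/-- The map `C ↦ f(C)*` as a morphism of Priestley spaces. -/
def map (f : X →Co Y) : ConvexClosed X →Co ConvexClosed Y where
  toFun := mapFun f
  monotone' A B h := by
    obtain ⟨h1, h2⟩ := le_def.1 h
    refine le_def.2 ⟨fun y hy => ?_, fun y hy => ?_⟩
    · obtain ⟨⟨a, ha, hya⟩, -⟩ := mem_mapFun.1 hy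
      obtain ⟨b, hb, hab⟩ := h1 a ha
      exact ⟨f b, subset_hull ⟨b, hb, rfl⟩, hya.trans (f.monotone' hab)⟩
    · obtain ⟨-, b, hb, hby⟩ := mem_mapFun.1 hy
      obtain ⟨a, ha, hab⟩ := h2 b hb
      exact ⟨f a, subset_hull ⟨a, ha, rfl⟩, (f.monotone' hab).trans hby⟩
  continuous_toFun := by
    refine continuous_generateFrom_iff.2 ?_
    rintro _ ⟨U, rfl | rfl | rfl | rfl⟩
    · rw [mapFun_preimage_miss f (Or.inl U.upper)]
      exact isOpen_miss (clopenUpperSetComap f U)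
    · rw [mapFun_preimage_miss f (Or.inr U.upper.compl)]
      exact isOpen_miss_compl (clopenUpperSetComap f U)
    · rw [mapFun_preimage_hit f (Or.inl U.upper)]
      exact isOpen_hit (clopenUpperSetComap f U)
    · rw [mapFun_preimage_hit f (Or.inr U.upper.compl)]
      exact isOpen_hit_compl (clopenUpperSetComap f U)

theorem mem_map {f : X →Co Y} {C : ConvexClosed X} {y : Y} :
    y ∈ map f C ↔ (∃ x ∈ C, y ≤ f x) ∧ ∃ x ∈ C, f x ≤ y := mem_mapFun

end Separation

end ConvexClosed

end ConvexClosed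

/-- The convex Vietoris endofunctor: `X` goes to its space of convex closed sets, with the
Egli-Milner order and the weak hit-or-miss topology, and `f` goes to `C ↦ f(C)*`. -/
def C : PS.{u} ⥤ PS.{u} where
  obj X := { carrier := ConvexClosed X }
  map {X Y} f := ConcreteCategory.ofHom (C := PS.{u})
    (X := { carrier := ConvexClosed X }) (Y := { carrier := ConvexClosed Y })
    (ConvexClosed.map (ConcreteCategory.hom f))
  map_id X := PS.hom_ext fun A => by
    refine SetLike.ext fun x => Iff.trans ConvexClosed.mem_map ⟨?_, fun hx => ?_⟩
    · rintro ⟨⟨a, ha, hxa⟩, b, hb, hbx⟩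
      exact ConvexClosed.convex A hb ha hbx hxa
    · exact ⟨⟨x, hx, le_rfl⟩, x, hx, le_rfl⟩
  map_comp {X Y Z} f g := PS.hom_ext fun A => by
    refine SetLike.ext fun z => Iff.trans ConvexClosed.mem_map
      (Iff.trans ?_ ConvexClosed.mem_map.symm)
    have hg : Monotone (ConcreteCategory.hom g) := (ConcreteCategory.hom g).monotone'
    constructor
    · rintro ⟨⟨a, ha, hza⟩, b, hb, hbz⟩
      exact ⟨⟨f a, ConvexClosed.mem_map.2 ⟨⟨a, ha, le_rfl⟩, a, ha, le_rfl⟩, hza⟩,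
        f b, ConvexClosed.mem_map.2 ⟨⟨b, hb, le_rfl⟩, b, hb, le_rfl⟩, hbz⟩
    · rintro ⟨⟨y, hy, hzy⟩, y', hy', hy'z⟩
      obtain ⟨⟨a, ha, hya⟩, -⟩ := ConvexClosed.mem_map.1 hy
      obtain ⟨-, b, hb, hby⟩ := ConvexClosed.mem_map.1 hy'
      exact ⟨⟨a, ha, hzy.trans (hg hya)⟩, b, hb, (hg hby).trans hy'z⟩

/-! ### The category of box-diamond pairs and the free construction -/

/-- A pair `(f, g)` where `f` preserves finite joins, `g` preserves finite meets,
`g (a ∨ b) ≤ g a ∨ f b` and `g a ∧ f b ≤ f (a ∧ b)`. -/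
@[ext]
structure DiaBoxHom (L M : Type*) [DistribLattice L] [BoundedOrder L] [DistribLattice M]
    [BoundedOrder M] where
  dia : SupBotHom L M
  box : InfTopHom L M
  box_sup_le : ∀ a b : L, box (a ⊔ b) ≤ box a ⊔ dia b
  le_dia_inf : ∀ a b : L, box a ⊓ dia b ≤ dia (a ⊓ b)

namespace DiaBoxHom

variable {L M N : Type*} [DistribLattice L] [BoundedOrder L] [DistribLattice M] [BoundedOrder M]
  [DistribLattice N] [BoundedOrder N]

variable (L) in
/-- The identity pair. -/
def id : DiaBoxHom L L where
  dia := SupBotHom.id L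
  box := InfTopHom.id L
  box_sup_le _ _ := le_rfl
  le_dia_inf _ _ := le_rfl

/-- Componentwise composition of pairs. -/
def comp (q : DiaBoxHom M N) (p : DiaBoxHom L M) : DiaBoxHom L N where
  dia := q.dia.comp p.dia
  box := q.box.comp p.box
  box_sup_le a b := (OrderHomClass.mono q.box (p.box_sup_le a b)).trans (q.box_sup_le _ _)
  le_dia_inf a b := (q.le_dia_inf _ _).trans (OrderHomClass.mono q.dia (p.le_dia_inf a b))

/-- The pair `(f, f)`. -/
def ofHom (f : BoundedLatticeHom L M) : DiaBoxHom L M where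
  dia := { toFun := f, map_sup' := map_sup f, map_bot' := map_bot f }
  box := { toFun := f, map_inf' := map_inf f, map_top' := map_top f }
  box_sup_le a b := (map_sup f a b).le
  le_dia_inf a b := (map_inf f a b).ge

end DiaBoxHom

/-- The category of bounded distributive lattices whose morphisms are the pairs `(f, g)` of
`DiaBoxHom`. -/
structure DLDiaBox : Type (u + 1) where
  toDL : BddDistLat.{u}

instance : Category DLDiaBox.{u} where
  Hom L M := DiaBoxHom L.toDL M.toDL
  id L := DiaBoxHom.id L.toDL
  comp p q := q.comp p

/-- The functor that is the identity on objects and sends `f` to `(f, f)`. -/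
def RFunctor : BddDistLat.{u} ⥤ DLDiaBox.{u} where
  obj A := ⟨A⟩
  map f := DiaBoxHom.ofHom f.hom

section Free

/-- Terms of bounded lattices in the symbols `□_a`, `◇_a`, for `a : L`. -/
inductive Term (L : Type u) : Type u
  | box (a : L) : Term L
  | dia (a : L) : Term L
  | top : Term L
  | bot : Term L
  | inf (s t : Term L) : Term L
  | sup (s t : Term L) : Term L

variable {L : Type u} [DistribLattice L] [BoundedOrder L]

/-- The order on terms that is derivable from the axioms of bounded distributive lattices and the
relations on the symbols. -/
inductive Term.Le : Term L → Term L → Prop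
  | refl (s) : Term.Le s s
  | trans {s t r} : Term.Le s t → Term.Le t r → Term.Le s r
  | le_top (s) : Term.Le s Term.top
  | bot_le (s) : Term.Le Term.bot s
  | inf_le_left (s t) : Term.Le (Term.inf s t) s
  | inf_le_right (s t) : Term.Le (Term.inf s t) t
  | le_inf {s t r} : Term.Le s t → Term.Le s r → Term.Le s (Term.inf t r)
  | le_sup_left (s t) : Term.Le s (Term.sup s t)
  | le_sup_right (s t) : Term.Le t (Term.sup s t)
  | sup_le {s t r} : Term.Le s r → Term.Le t r → Term.Le (Term.sup s t) r
  | distrib (s t r) : Term.Le (Term.inf (Term.sup s t) (Term.sup s r)) (Term.sup s (Term.inf t r))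
  | dia_bot : Term.Le (Term.dia ⊥) Term.bot
  | dia_sup_le (a b : L) : Term.Le (Term.dia (a ⊔ b)) (Term.sup (Term.dia a) (Term.dia b))
  | le_dia_sup (a b : L) : Term.Le (Term.sup (Term.dia a) (Term.dia b)) (Term.dia (a ⊔ b))
  | box_top : Term.Le Term.top (Term.box ⊤)
  | box_inf_le (a b : L) : Term.Le (Term.box (a ⊓ b)) (Term.inf (Term.box a) (Term.box b))
  | le_box_inf (a b : L) : Term.Le (Term.inf (Term.box a) (Term.box b)) (Term.box (a ⊓ b))
  | box_sup_le (a b : L) : Term.Le (Term.box (a ⊔ b)) (Term.sup (Term.box a) (Term.dia b))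
  | le_dia_inf (a b : L) : Term.Le (Term.inf (Term.box a) (Term.dia b)) (Term.dia (a ⊓ b))

variable (L) in
/-- Two terms are identified when each is below the other. -/
def termSetoid : Setoid (Term L) where
  r s t := Term.Le s t ∧ Term.Le t s
  iseqv :=
    { refl := fun s => ⟨.refl s, .refl s⟩
      symm := fun h => ⟨h.2, h.1⟩
      trans := fun h k => ⟨h.1.trans k.1, k.2.trans h.2⟩ }

variable (L) in
/-- The bounded distributive lattice freely generated by the symbols `□_a`, `◇_a` for `a : L`,
modulo the relations `◇_0 = 0`, `◇_a ∨ ◇_b = ◇_{a ∨ b}`, `□_1 = 1`, `□_a ∧ □_b = □_{a ∧ b}`,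
`□_{a ∨ b} ≤ □_a ∨ ◇_b` and `□_a ∧ ◇_b ≤ ◇_{a ∧ b}`. -/
def FreeDiaBox : Type u := Quotient (termSetoid L)

namespace FreeDiaBox

/-- The class of a term. -/
def mk (s : Term L) : FreeDiaBox L := Quotient.mk (termSetoid L) s

/-- The order on classes of terms. -/
def le : FreeDiaBox L → FreeDiaBox L → Prop :=
  Quotient.lift₂ (fun s t : Term L => Term.Le s t) fun _ _ _ _ h k =>
    propext ⟨fun e => h.2.trans (e.trans k.1), fun e => h.1.trans (e.trans k.2)⟩

/-- The join on classes of terms. -/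
def sup : FreeDiaBox L → FreeDiaBox L → FreeDiaBox L :=
  Quotient.map₂ Term.sup fun _ _ h _ _ k =>
    ⟨.sup_le (h.1.trans (.le_sup_left _ _)) (k.1.trans (.le_sup_right _ _)),
      .sup_le (h.2.trans (.le_sup_left _ _)) (k.2.trans (.le_sup_right _ _))⟩

/-- The meet on classes of terms. -/
def inf : FreeDiaBox L → FreeDiaBox L → FreeDiaBox L :=
  Quotient.map₂ Term.inf fun _ _ h _ _ k =>
    ⟨.le_inf (.trans (.inf_le_left _ _) h.1) (.trans (.inf_le_right _ _) k.1),
      .le_inf (.trans (.inf_le_left _ _) h.2) (.trans (.inf_le_right _ _) k.2)⟩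

instance : DistribLattice (FreeDiaBox L) where
  le := le
  le_refl := by rintro ⟨s⟩; exact .refl s
  le_trans := by rintro ⟨s⟩ ⟨t⟩ ⟨r⟩ h k; exact Term.Le.trans h k
  le_antisymm := by rintro ⟨s⟩ ⟨t⟩ h k; exact Quotient.sound ⟨h, k⟩
  sup := sup
  inf := inf
  le_sup_left := by rintro ⟨s⟩ ⟨t⟩; exact .le_sup_left s t
  le_sup_right := by rintro ⟨s⟩ ⟨t⟩; exact .le_sup_right s t
  sup_le := by rintro ⟨s⟩ ⟨t⟩ ⟨r⟩ h k; exact Term.Le.sup_le h k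
  inf_le_left := by rintro ⟨s⟩ ⟨t⟩; exact .inf_le_left s t
  inf_le_right := by rintro ⟨s⟩ ⟨t⟩; exact .inf_le_right s t
  le_inf := by rintro ⟨s⟩ ⟨t⟩ ⟨r⟩ h k; exact Term.Le.le_inf h k
  le_sup_inf := by rintro ⟨s⟩ ⟨t⟩ ⟨r⟩; exact .distrib s t r

theorem mk_le_mk {s t : Term L} : mk s ≤ mk t ↔ Term.Le s t := Iff.rfl

instance : BoundedOrder (FreeDiaBox L) where
  top := mk Term.top
  le_top := by rintro ⟨s⟩; exact .le_top s
  bot := mk Term.bot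
  bot_le := by rintro ⟨s⟩; exact .bot_le s

/-- The generator `□_a`. -/
def box (a : L) : FreeDiaBox L := mk (Term.box a)

/-- The generator `◇_a`. -/
def dia (a : L) : FreeDiaBox L := mk (Term.dia a)

variable (L) in
/-- The universal pair `(◇, □)`. -/
def unit : DiaBoxHom L (FreeDiaBox L) where
  dia :=
    { toFun := dia
      map_sup' := fun a b => Quotient.sound ⟨.dia_sup_le a b, .le_dia_sup a b⟩
      map_bot' := Quotient.sound ⟨.dia_bot, .bot_le _⟩ }
  box :=
    { toFun := box
      map_inf' := fun a b => Quotient.sound ⟨.box_inf_le a b, .le_box_inf a b⟩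
      map_top' := Quotient.sound ⟨.le_top _, .box_top⟩ }
  box_sup_le := .box_sup_le
  le_dia_inf := .le_dia_inf

section Lift

variable {M : Type v} [DistribLattice M] [BoundedOrder M]

/-- Evaluation of terms along a pair. -/
def eval (p : DiaBoxHom L M) : Term L → M
  | .box a => p.box a
  | .dia a => p.dia a
  | .top => ⊤
  | .bot => ⊥
  | .inf s t => eval p s ⊓ eval p t
  | .sup s t => eval p s ⊔ eval p t

theorem eval_mono (p : DiaBoxHom L M) {s t : Term L} (h : Term.Le s t) : eval p s ≤ eval p t := by
  induction h with
  | refl s => exact le_rfl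
  | trans _ _ h k => exact h.trans k
  | le_top s => exact le_top
  | bot_le s => exact bot_le
  | inf_le_left s t => exact inf_le_left
  | inf_le_right s t => exact inf_le_right
  | le_inf _ _ h k => exact le_inf h k
  | le_sup_left s t => exact le_sup_left
  | le_sup_right s t => exact le_sup_right
  | sup_le _ _ h k => exact sup_le h k
  | distrib s t r => exact le_sup_inf
  | dia_bot => exact (map_bot p.dia).le
  | dia_sup_le a b => exact (map_sup p.dia a b).le
  | le_dia_sup a b => exact (map_sup p.dia a b).ge
  | box_top => exact (map_top p.box).ge
  | box_inf_le a b => exact (map_inf p.box a b).le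
  | le_box_inf a b => exact (map_inf p.box a b).ge
  | box_sup_le a b => exact p.box_sup_le a b
  | le_dia_inf a b => exact p.le_dia_inf a b

/-- The homomorphism induced by a pair. -/
def lift (p : DiaBoxHom L M) : BoundedLatticeHom (FreeDiaBox L) M where
  toFun := Quotient.lift (eval p) fun _ _ h => le_antisymm (eval_mono p h.1) (eval_mono p h.2)
  map_sup' := by rintro ⟨s⟩ ⟨t⟩; rfl
  map_inf' := by rintro ⟨s⟩ ⟨t⟩; rfl
  map_top' := rfl
  map_bot' := rfl

@[simp]
theorem lift_box (p : DiaBoxHom L M) (a : L) : lift p (box a) = p.box a := rfl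

@[simp]
theorem lift_dia (p : DiaBoxHom L M) (a : L) : lift p (dia a) = p.dia a := rfl

theorem hom_ext {h k : BoundedLatticeHom (FreeDiaBox L) M} (hbox : ∀ a, h (box a) = k (box a))
    (hdia : ∀ a, h (dia a) = k (dia a)) : h = k := by
  refine DFunLike.ext _ _ ?_
  rintro ⟨s⟩
  change h (mk s) = k (mk s)
  induction s with
  | box a => exact hbox a
  | dia a => exact hdia a
  | top => exact (map_top h).trans (map_top k).symm
  | bot => exact (map_bot h).trans (map_bot k).symm
  | inf s t hs ht =>
    change h (mk s ⊓ mk t) = k (mk s ⊓ mk t)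
    rw [map_inf, map_inf, hs, ht]
  | sup s t hs ht =>
    change h (mk s ⊔ mk t) = k (mk s ⊔ mk t)
    rw [map_sup, map_sup, hs, ht]

end Lift

/-- The homomorphism `◇_a ↦ ◇_{f a}`, `□_a ↦ □_{g a}` induced by a pair `(f, g)`. -/
def map {M : Type v} [DistribLattice M] [BoundedOrder M] (p : DiaBoxHom L M) :
    BoundedLatticeHom (FreeDiaBox L) (FreeDiaBox M) :=
  lift ((unit M).comp p)

end FreeDiaBox

end Free

/-- The functor sending `L` to `L^{◇□}` and a pair `(f, g)` to the homomorphism with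
`◇_a ↦ ◇_{f a}` and `□_a ↦ □_{g a}`. -/
def LFunctor : DLDiaBox.{u} ⥤ BddDistLat.{u} where
  obj A := BddDistLat.of (FreeDiaBox A.toDL)
  map p := BddDistLat.ofHom (FreeDiaBox.map p)
  map_id _ := BddDistLat.hom_ext (FreeDiaBox.hom_ext (fun _ => by rfl) fun _ => by rfl)
  map_comp _ _ := BddDistLat.hom_ext (FreeDiaBox.hom_ext (fun _ => by rfl) fun _ => by rfl)

/-- `LFunctor` is left adjoint to `RFunctor`: pairs `A → M` correspond to homomorphisms
`A^{◇□} → M`. -/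
def adjunction : LFunctor.{u} ⊣ RFunctor.{u} :=
  Adjunction.mkOfHomEquiv
    { homEquiv := fun A M =>
        { toFun := fun h => (DiaBoxHom.ofHom h.hom).comp (FreeDiaBox.unit A.toDL)
          invFun := fun p => BddDistLat.ofHom (FreeDiaBox.lift p)
          left_inv := fun h => BddDistLat.hom_ext
            (FreeDiaBox.hom_ext (fun _ => by rfl) fun _ => by rfl)
          right_inv := fun p => by rfl }
      homEquiv_naturality_left_symm := fun f g => BddDistLat.hom_ext
        (FreeDiaBox.hom_ext (fun _ => by rfl) fun _ => by rfl)
      homEquiv_naturality_right := fun f g => by rfl }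

/-- The endofunctor `LFunctor ∘ RFunctor` of the category of bounded distributive lattices. -/
def K : BddDistLat.{u} ⥤ BddDistLat.{u} := RFunctor ⋙ LFunctor

/-- The element `□_a` of `K A`. -/
def box {A : BddDistLat.{u}} (a : A) : K.obj A := FreeDiaBox.box a

/-- The element `◇_a` of `K A`. -/
def dia {A : BddDistLat.{u}} (a : A) : K.obj A := FreeDiaBox.dia a

end PriestleyDuality

/-! The proof is Priestley duality carried out by hand for `L^{◇□}`. The sets `◇_{a⁺}` and `□_{a⁻}`
satisfy the defining relations of the generators, so freeness gives a homomorphism `ε_L` from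
`L^{◇□}` to the clopen upsets of `C(P(L))`; it remains to see that it is bijective and natural.

Surjectivity is a compactness argument: a bounded sublattice of clopen upsets that witnesses every
`x ≰ y` is everything (`mem_range_of_separating`). If `A ⋢ B` in the Egli-Milner order, one of the
two inclusions fails, and the failure is witnessed by a diamond or by a box.

Injectivity rests on a description of the prime filters of `L^{◇□}`: such an `F` is recovered from
the set of prime filters `x` of `L` with `□⁻¹(F) ⊆ x ⊆ ◇⁻¹(F)`, in that `s ∈ F` iff this set belongs
to `ε_L(s)` (`mem_iff_toConvexClosed_mem`). For generators this is the prime filter theorem, and the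
two mixed relations between `□` and `◇` are exactly what it needs (`dia_mem_iff_exists`,
`box_mem_iff_forall`). Since prime filters separate elements, `ε_L` is injective.

The isomorphisms `ψ` and `φ` then follow formally by composing `ε` with `η`, which is invertible by
compactness (`eta_surjective`) and natural. -/

namespace PriestleyDuality

/-! ### Separating sublattices of clopen upsets -/

section Separation

variable {X : Type u} [TopologicalSpace X] [PartialOrder X] [CompactSpace X]

/-- A bounded sublattice of clopen upsets that separates `x` from `y` whenever `x ≰ y` contains all
clopen upsets. -/
theorem mem_range_of_separating {L : Type v} [DistribLattice L] [BoundedOrder L]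
    (h : BoundedLatticeHom L (ClopenUpperSet X))
    (sep : ∀ x y : X, ¬ x ≤ y → ∃ a, x ∈ h a ∧ y ∉ h a) (W : ClopenUpperSet X) :
    ∃ a, h a = W := by
  classical
  -- For fixed `x`, the complements of the separating sets cover the compact set `Wᶜ`, so a finite
  -- meet of separators stays inside `W`.
  have inner : ∀ x ∈ W, ∃ a, x ∈ h a ∧ h a ≤ W := by
    intro x hx
    have hy : ∀ y : X, y ∉ W → ∃ a, x ∈ h a ∧ y ∉ h a := fun y hy =>
      sep x y fun hxy => hy (W.upper hxy hx)
    choose! a hxa hya using hy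
    obtain ⟨t, htW, ht⟩ := W.isClopen.compl.isClosed.isCompact.elim_nhds_subcover
      (fun y => ((h (a y) : ClopenUpperSet X) : Set X)ᶜ)
      (fun y hy => (h (a y)).isClopen.compl.isOpen.mem_nhds (hya y hy))
    refine ⟨t.inf a, ?_, ?_⟩
    · have : ∀ s : Finset X, (∀ y ∈ s, y ∉ W) → x ∈ h (s.inf a) := by
        intro s
        induction s using Finset.induction_on with
        | empty => intro _; rw [Finset.inf_empty, map_top]; exact Set.mem_univ x
        | insert y s _ ih =>
          intro hs
          rw [Finset.inf_insert, map_inf]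
          exact ⟨hxa y (hs y (by simp)), ih fun z hz => hs z (by simp [hz])⟩
      exact this t htW
    · intro z hz
      by_contra hzW
      obtain ⟨y, hyt, hzy⟩ := Set.mem_iUnion₂.1 (ht hzW)
      exact hzy ((OrderHomClass.mono h (Finset.inf_le hyt) : h (t.inf a) ≤ h (a y)) hz)
  choose! a hxa haW using inner
  -- Second use of compactness: `W` is a union of sets in the range, hence a finite join of them.
  obtain ⟨t, htW, ht⟩ := W.isClopen.isClosed.isCompact.elim_nhds_subcover
    (fun x => ((h (a x) : ClopenUpperSet X) : Set X))
    (fun x hx => (h (a x)).isClopen.isOpen.mem_nhds (hxa x hx))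
  refine ⟨t.sup a, le_antisymm ?_ ?_⟩
  · rw [map_finset_sup]
    exact Finset.sup_le fun x hx => haW x (htW x hx)
  · intro z hz
    obtain ⟨x, hxt, hzx⟩ := Set.mem_iUnion₂.1 (ht hz)
    exact (OrderHomClass.mono h (Finset.le_sup hxt) : h (a x) ≤ h (t.sup a)) hzx

end Separation

/-! ### Prime filters and the sets `a⁺` -/

section Plus

variable {L : Type u} [DistribLattice L] [BoundedOrder L]

namespace PrimeFilter

variable (L) in
/-- The homomorphism `a ↦ a⁺`. -/
def plusHom : BoundedLatticeHom L (ClopenUpperSet (PrimeFilter L)) where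
  toFun a := ⟨⟨plus a, isClopen_plus a⟩, isUpperSet_plus a⟩
  map_sup' _ _ := SetLike.ext fun x => x.sup_mem_iff
  map_inf' _ _ := SetLike.ext fun x => x.inf_mem_iff
  map_top' := SetLike.ext fun x => ⟨fun _ => trivial, fun _ => x.top_mem⟩
  map_bot' := SetLike.ext fun x => iff_of_false x.bot_notMem (Set.notMem_empty x)

/-- For the inclusion order, `x ≰ y` means precisely that some `a` lies in `x` and not in `y`, so
the sets `a⁺` separate. -/
theorem exists_plusHom_eq (U : ClopenUpperSet (PrimeFilter L)) : ∃ a, plusHom L a = U :=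
  mem_range_of_separating (plusHom L) (fun x y hxy => by
    rw [le_def] at hxy
    push Not at hxy
    exact hxy) U

theorem finset_inf_mem (x : PrimeFilter L) {s : Finset L} (h : ∀ a ∈ s, a ∈ x) :
    s.inf id ∈ x := by
  classical
  induction s using Finset.induction_on with
  | empty => exact x.top_mem
  | insert a s _ ih =>
    rw [Finset.inf_insert]
    exact x.inf_mem_iff.2 ⟨h a (by simp), ih fun b hb => h b (by simp [hb])⟩

theorem finset_sup_notMem (x : PrimeFilter L) {s : Finset L} (h : ∀ a ∈ s, a ∉ x) :
    s.sup id ∉ x := by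
  classical
  induction s using Finset.induction_on with
  | empty => exact x.bot_notMem
  | insert a s _ ih =>
    rw [Finset.sup_insert, x.sup_mem_iff, not_or]
    exact ⟨h a (by simp), ih fun b hb => h b (by simp [hb])⟩

/-- A form of the prime filter theorem for an ideal `A` and a filter `B`. -/
theorem exists_separating_of_directed {A B : Set L} (bot : ⊥ ∈ A)
    (sup : ∀ a ∈ A, ∀ b ∈ A, a ⊔ b ∈ A) (top : ⊤ ∈ B) (inf : ∀ a ∈ B, ∀ b ∈ B, a ⊓ b ∈ B)
    (h : ∀ a ∈ A, ∀ b ∈ B, ¬ b ≤ a) :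
    ∃ x : PrimeFilter L, (∀ a ∈ A, a ∉ x) ∧ ∀ b ∈ B, b ∈ x :=
  exists_separating fun _ _ hs ht =>
    h _ (Finset.sup_induction bot sup fun _ ha => hs ha)
      _ (Finset.inf_induction top inf fun _ hb => ht hb)

theorem exists_mem_notMem {a b : L} (h : ¬ a ≤ b) : ∃ x : PrimeFilter L, a ∈ x ∧ b ∉ x := by
  obtain ⟨x, h1, h2⟩ := exists_separating_of_directed (A := Set.Iic b) (B := Set.Ici a)
    bot_le (fun _ hc _ hd => sup_le hc hd) le_top (fun _ hc _ hd => le_inf hc hd)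
    (fun c hc d hd hdc => h ((hd.trans hdc).trans hc))
  exact ⟨x, h2 a le_rfl, h1 b le_rfl⟩

end PrimeFilter

end Plus

/-! ### Invertibility and naturality of `η` -/

section Eta

/-- A continuous bijection from a compact space to a Hausdorff one is a homeomorphism, and order
reflection makes its inverse monotone. -/
theorem PS.isIso_of_orderEmbedding_of_surjective {X Y : PS.{u}} (f : X ⟶ Y)
    (hle : ∀ x y : X, f x ≤ f y → x ≤ y) (hf : Function.Surjective f) : IsIso f := by
  have hmono : Monotone f := (ConcreteCategory.hom f).monotone'
  have hcont : Continuous f := (ConcreteCategory.hom f).continuous_toFun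
  have hinj : Function.Injective f := fun x y h =>
    le_antisymm (hle x y h.le) (hle y x h.ge)
  let e : X ≃ Y := Equiv.ofBijective f ⟨hinj, hf⟩
  have he : ∀ y, f (e.symm y) = y := e.apply_symm_apply
  let g : Y ⟶ X := ConcreteCategory.ofHom (C := PS.{u})
    { toFun := e.symm
      monotone' := fun x y hxy => hle _ _ (by rwa [he, he])
      continuous_toFun := Continuous.continuous_symm_of_equiv_compact_to_t2 (f := e) hcont }
  exact ⟨g, PS.hom_ext fun x => e.symm_apply_apply x, PS.hom_ext fun y => he y⟩

/-- If no point realises `F`, each `x` has a clopen upset `U` for which `x ∈ U` and `U ∈ F`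
disagree. The points agreeing with `x` about `U` form an open neighbourhood of `x`, and finitely
many of these cover `X`. Among the finitely many sets `U`, the meet of those in `F` then lies below
the join of those outside `F`, which a prime filter forbids. -/
theorem eta_surjective (X : PS.{u}) : Function.Surjective (eta X) := by
  classical
  intro F
  change PrimeFilter (ClopenUpperSet X) at F
  by_contra hc
  have hx : ∀ x : X, ∃ U : ClopenUpperSet X, ¬ (x ∈ U ↔ U ∈ F) := by
    intro x
    by_contra hx
    push Not at hx
    exact hc ⟨x, SetLike.ext (A := PrimeFilter (ClopenUpperSet X)) hx⟩
  obtain ⟨t, -, ht⟩ := isCompact_univ.elim_nhds_subcover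
    (fun x : X => {z | z ∈ (hx x).choose ↔ x ∈ (hx x).choose}) (fun x _ => by
      by_cases h : x ∈ (hx x).choose
      · simp only [h, iff_true]
        exact (hx x).choose.isClopen.isOpen.mem_nhds h
      · simp only [h, iff_false]
        exact (hx x).choose.isClopen.compl.isOpen.mem_nhds h)
  let V : Finset (ClopenUpperSet X) := t.image fun x => (hx x).choose
  have hinf := F.finset_inf_mem (s := V.filter (· ∈ F)) (by simp)
  have hsup := F.finset_sup_notMem (s := V.filter (· ∉ F)) (by simp)
  refine hsup (PrimeFilter.mem_of_le (F := F) (fun z hz => ?_) hinf)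
  obtain ⟨x, hxt, hzx⟩ := Set.mem_iUnion₂.1 (ht (Set.mem_univ z))
  have hspec := (hx x).choose_spec
  have hV : (hx x).choose ∈ V := Finset.mem_image_of_mem _ hxt
  change z ∈ (hx x).choose ↔ x ∈ (hx x).choose at hzx
  -- With `U` the set chosen for `x`: if `U ∈ F`, then `z ∈ U`, so `x ∈ U`, and there is no
  -- disagreement at `x`. If `U ∉ F`, disagreement forces `x ∈ U`, so `z ∈ U`.
  by_cases hF : (hx x).choose ∈ F
  · exfalso
    have hle : (V.filter (· ∈ F)).inf id ≤ (hx x).choose :=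
      Finset.inf_le (f := id) (Finset.mem_filter.2 ⟨hV, hF⟩)
    have := hle hz
    exact hspec ⟨fun _ => hF, fun _ => hzx.1 this⟩
  · have hle : (hx x).choose ≤ (V.filter (· ∉ F)).sup id :=
      Finset.le_sup (f := id) (Finset.mem_filter.2 ⟨hV, hF⟩)
    refine hle (hzx.2 ?_)
    by_contra hxU
    exact hspec ⟨fun h => (hxU h).elim, fun h => (hF h).elim⟩

/-- Order reflection for `η` is the Priestley separation axiom. -/
instance isIso_eta (X : PS.{u}) : IsIso (eta X) :=
  PS.isIso_of_orderEmbedding_of_surjective (eta X) (fun x y hxy => by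
    by_contra h
    obtain ⟨U, hU, hU', hxU, hyU⟩ := exists_isClopen_upper_of_not_le h
    exact hyU (hxy (show (⟨⟨U, hU⟩, hU'⟩ : ClopenUpperSet X) ∈
      (show PrimeFilter (ClopenUpperSet X) from eta X x) from hxU))) (eta_surjective X)

/-- The canonical isomorphism `X ≅ P (CU X)`. -/
noncomputable def etaIso (X : PS.{u}) : X ≅ P.obj (Opposite.op (CU.obj (Opposite.op X))) :=
  asIso (eta X)

theorem eta_naturality {X Y : PS.{u}} (f : X ⟶ Y) :
    f ≫ eta Y = eta X ≫ P.map (CU.map f.op).op :=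
  PS.hom_ext fun _ => rfl

end Eta

/-! ### Bijectivity of `L^{◇□} → CU(C(P(L)))` -/

section Epsilon

open ConvexClosed PrimeFilter

variable {L : Type u} [DistribLattice L] [BoundedOrder L]

variable (L) in
/-- The pair `a ↦ ◇_{a⁺}`, `a ↦ □_{a⁻}`. -/
def hitMiss : DiaBoxHom L (ClopenUpperSet (ConvexClosed (PrimeFilter L))) where
  dia :=
    { toFun := fun a => ⟨⟨hit (plus a), isClopen_hit (plusHom L a)⟩, isUpperSet_hit (plusHom L a)⟩
      map_sup' := fun a b => SetLike.ext fun A => by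
        refine Iff.trans ?_ (Iff.symm (Set.mem_union _ _ _))
        constructor
        · rintro ⟨x, hx, h⟩
          exact (x.sup_mem_iff.1 h).imp (fun h => ⟨x, hx, h⟩) fun h => ⟨x, hx, h⟩
        · rintro (⟨x, hx, h⟩ | ⟨x, hx, h⟩)
          · exact ⟨x, hx, x.sup_mem_iff.2 (Or.inl h)⟩
          · exact ⟨x, hx, x.sup_mem_iff.2 (Or.inr h)⟩
      map_bot' := SetLike.ext fun A =>
        iff_of_false (fun h : A ∈ hit (plus ⊥) => h.elim fun x h => x.bot_notMem h.2)
          (Set.notMem_empty A) }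
  box :=
    -- `a⁻` is by definition the complement of the clopen upset `a⁺`.
    { toFun := fun a => ⟨⟨miss (minus a), isClopen_miss_compl (plusHom L a)⟩,
        isUpperSet_miss_compl (plusHom L a)⟩
      map_inf' := fun a b => SetLike.ext fun A => by
        refine Iff.trans mem_miss (Iff.trans ?_ (and_congr mem_miss mem_miss).symm)
        simp only [minus, Set.mem_ofPred_eq, not_not, inf_mem_iff, forall_and]
      map_top' := SetLike.ext fun A =>
        ⟨fun _ => trivial, fun _ => mem_miss.2 fun x _ h => h x.top_mem⟩ }
  box_sup_le a b A hA := by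
    by_cases h : ∃ x ∈ A, b ∈ x
    · exact Or.inr h
    · refine Or.inl (mem_miss.2 fun x hx hxa => mem_miss.1 hA x hx fun hab => ?_)
      exact (x.sup_mem_iff.1 hab).elim hxa fun hb => h ⟨x, hx, hb⟩
  le_dia_inf a b := by
    rintro A ⟨hA, x, hx, hb⟩
    exact ⟨x, hx, x.inf_mem_iff.2 ⟨not_not.1 (mem_miss.1 hA x hx), hb⟩⟩

theorem mem_hitMiss_box {a : L} {A : ConvexClosed (PrimeFilter L)} :
    A ∈ (hitMiss L).box a ↔ ∀ x ∈ A, a ∈ x :=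
  mem_miss.trans (forall₂_congr fun _ _ => not_not)

variable (L) in
/-- The homomorphism `◇_a ↦ ◇_{a⁺}`, `□_a ↦ □_{a⁻}`. -/
def epsilonHom :
    BoundedLatticeHom (FreeDiaBox L) (ClopenUpperSet (ConvexClosed (PrimeFilter L))) :=
  FreeDiaBox.lift (hitMiss L)

/-- The two kinds of generator match the two halves of the Egli-Milner order: a failure of `B ⊆ ↑A`
is detected by a box, a failure of `A ⊆ ↓B` by a diamond. The separating clopen upset of `P(L)` has
the form `a⁺` by `exists_plusHom_eq`. -/
theorem epsilonHom_surjective : Function.Surjective (epsilonHom L) := by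
  refine mem_range_of_separating (epsilonHom L) fun A B hAB => ?_
  by_cases h1 : (A : Set (PrimeFilter L)) ⊆ lowerClosure (B : Set (PrimeFilter L))
  · have h2 : ¬ (B : Set (PrimeFilter L)) ⊆ upperClosure (A : Set (PrimeFilter L)) :=
      fun h2 => hAB ⟨h1, h2⟩
    obtain ⟨x, hxB, hx⟩ := Set.not_subset.1 h2
    obtain ⟨U, hxU, hU⟩ := exists_clopen_of_notMem_upperClosure A.isClosed.isCompact hx
    obtain ⟨a, rfl⟩ := exists_plusHom_eq U
    exact ⟨FreeDiaBox.box a, mem_hitMiss_box.2 hU, fun h => hxU (mem_hitMiss_box.1 h x hxB)⟩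
  · obtain ⟨x, hxA, hx⟩ := Set.not_subset.1 h1
    obtain ⟨U, hxU, hU⟩ := exists_clopen_of_notMem_lowerClosure B.isClosed.isCompact hx
    obtain ⟨a, rfl⟩ := exists_plusHom_eq U
    exact ⟨FreeDiaBox.dia a, ⟨x, hxA, hxU⟩, fun ⟨y, hyB, hy⟩ => hU y hyB hy⟩

/-- The convex closed set of prime filters associated with a prime filter of `L^{◇□}`. -/
def toConvexClosed (F : PrimeFilter (FreeDiaBox L)) : ConvexClosed (PrimeFilter L) where
  -- This set is forced. If `F` consists of the `s` with `A ∈ ε(s)`, the first condition says that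
  -- `x` lies in every clopen upset containing `A`, so `x ∈ ↑A`; the second says that every clopen
  -- upset around `x` hits `A`, so `x ∈ ↓A`. By convexity the set is `A`.
  carrier := {x | (∀ a, FreeDiaBox.box a ∈ F → a ∈ x) ∧ ∀ a ∈ x, FreeDiaBox.dia a ∈ F}
  isClosed' := by
    have : {x : PrimeFilter L | (∀ a, FreeDiaBox.box a ∈ F → a ∈ x) ∧
        ∀ a ∈ x, FreeDiaBox.dia a ∈ F} =
        (⋂ a : {a : L // FreeDiaBox.box a ∈ F}, plus a.1) ∩
          ⋂ a : {a : L // FreeDiaBox.dia a ∉ F}, minus a.1 := by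
      ext x
      simp only [Set.mem_ofPred_eq, Set.mem_inter_iff, Set.mem_iInter, Subtype.forall]
      exact and_congr Iff.rfl (forall_congr' fun a => not_imp_not.symm)
    rw [this]
    exact (isClosed_iInter fun a => (isClopen_plus _).isClosed).inter
      (isClosed_iInter fun a => (isClopen_plus _).compl.isClosed)
  -- The lower bound on `z` is inherited from `x`, the upper bound from `y`.
  convex' := fun x hx y hy z hxz hzy =>
    ⟨fun a ha => hxz (hx.1 a ha), fun a ha => hy.2 a (hzy ha)⟩

theorem dia_bot_notMem (F : PrimeFilter (FreeDiaBox L)) : FreeDiaBox.dia (⊥ : L) ∉ F := by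
  rw [show FreeDiaBox.dia (⊥ : L) = ⊥ from map_bot (FreeDiaBox.unit L).dia]
  exact F.bot_notMem

theorem dia_sup_mem_iff {F : PrimeFilter (FreeDiaBox L)} {a b : L} :
    FreeDiaBox.dia (a ⊔ b) ∈ F ↔ FreeDiaBox.dia a ∈ F ∨ FreeDiaBox.dia b ∈ F := by
  rw [← F.sup_mem_iff]
  exact iff_of_eq (congrArg (· ∈ F) (map_sup (FreeDiaBox.unit L).dia a b))

theorem box_top_mem (F : PrimeFilter (FreeDiaBox L)) : FreeDiaBox.box (⊤ : L) ∈ F := by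
  rw [show FreeDiaBox.box (⊤ : L) = ⊤ from map_top (FreeDiaBox.unit L).box]
  exact F.top_mem

theorem box_inf_mem_iff {F : PrimeFilter (FreeDiaBox L)} {a b : L} :
    FreeDiaBox.box (a ⊓ b) ∈ F ↔ FreeDiaBox.box a ∈ F ∧ FreeDiaBox.box b ∈ F := by
  rw [← F.inf_mem_iff]
  exact iff_of_eq (congrArg (· ∈ F) (map_inf (FreeDiaBox.unit L).box a b))

/-- The required `x` separates the ideal `{b | ◇_b ∉ F}` from the filter generated by `□⁻¹(F)` and
`a`. These are disjoint: if `c ⊓ a ≤ d` with `□_c ∈ F`, then `□_c ⊓ ◇_a ≤ ◇_{c ⊓ a} ≤ ◇_d` puts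
`◇_d` in `F`. -/
theorem dia_mem_iff_exists {F : PrimeFilter (FreeDiaBox L)} {a : L} :
    FreeDiaBox.dia a ∈ F ↔ ∃ x ∈ toConvexClosed F, a ∈ x := by
  refine ⟨fun ha => ?_, fun ⟨x, hx, hax⟩ => hx.2 a hax⟩
  obtain ⟨x, h1, h2⟩ := exists_separating_of_directed (L := L)
    (A := {b | FreeDiaBox.dia b ∉ F}) (B := {b | ∃ c, FreeDiaBox.box c ∈ F ∧ c ⊓ a ≤ b})
    (dia_bot_notMem F) (fun b hb c hc h => (dia_sup_mem_iff.1 h).elim hb hc)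
    ⟨⊤, box_top_mem F, le_top⟩
    (by
      rintro b ⟨c, hc, hcb⟩ b' ⟨c', hc', hcb'⟩
      exact ⟨c ⊓ c', box_inf_mem_iff.2 ⟨hc, hc'⟩, le_inf
        ((inf_le_inf_right a inf_le_left).trans hcb)
        ((inf_le_inf_right a inf_le_right).trans hcb')⟩)
    (by
      rintro d hd b ⟨c, hc, hcb⟩ hbd
      refine hd (PrimeFilter.mem_of_le ?_ (F.inf_mem_iff.2 ⟨hc, ha⟩))
      exact ((FreeDiaBox.unit L).le_dia_inf c a).trans
        (OrderHomClass.mono (FreeDiaBox.unit L).dia (hcb.trans hbd)))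
  refine ⟨x, ⟨fun c hc => h2 c ⟨c, hc, inf_le_left⟩, fun b hb => ?_⟩,
    h2 a ⟨⊤, box_top_mem F, inf_le_right⟩⟩
  by_contra h
  exact h1 b h hb

/-- Order dual of the diamond case: when `□_a ∉ F`, the filter `□⁻¹(F)` is separated from the ideal
generated by `a` and `{c | ◇_c ∉ F}`. Disjointness now comes from `□_{a ⊔ c} ≤ □_a ⊔ ◇_c` and
primeness of `F`. -/
theorem box_mem_iff_forall {F : PrimeFilter (FreeDiaBox L)} {a : L} :
    FreeDiaBox.box a ∈ F ↔ ∀ x ∈ toConvexClosed F, a ∈ x := by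
  refine ⟨fun ha x hx => hx.1 a ha, fun h => ?_⟩
  by_contra ha
  obtain ⟨x, h1, h2⟩ := exists_separating_of_directed (L := L)
    (A := {b | ∃ c, FreeDiaBox.dia c ∉ F ∧ b ≤ a ⊔ c}) (B := {b | FreeDiaBox.box b ∈ F})
    ⟨⊥, dia_bot_notMem F, bot_le⟩
    (by
      rintro b ⟨c, hc, hcb⟩ b' ⟨c', hc', hcb'⟩
      exact ⟨c ⊔ c', fun h => (dia_sup_mem_iff.1 h).elim hc hc', sup_le
        (hcb.trans (sup_le_sup_left le_sup_left a))
        (hcb'.trans (sup_le_sup_left le_sup_right a))⟩)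
    (box_top_mem F) (fun b hb c hc => box_inf_mem_iff.2 ⟨hb, hc⟩)
    (by
      rintro d ⟨c, hc, hdc⟩ b hb hbd
      have hle : FreeDiaBox.box b ≤ FreeDiaBox.box a ⊔ FreeDiaBox.dia c :=
        (OrderHomClass.mono (FreeDiaBox.unit L).box (hbd.trans hdc)).trans
          ((FreeDiaBox.unit L).box_sup_le a c)
      exact (F.sup_mem_iff.1 (PrimeFilter.mem_of_le hle hb)).elim ha hc)
  -- The separating `x` omits `a`, yet belongs to the convex closed set of `F`, all of whose members
  -- contain `a` by hypothesis.
  refine h1 a ⟨⊥, dia_bot_notMem F, le_sup_left⟩ (h x ⟨h2, fun b hb => ?_⟩)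
  by_contra hb'
  exact h1 b ⟨b, hb', le_sup_right⟩ hb

/-- Both sides turn meets into conjunctions and, `F` being prime, joins into disjunctions, so the
generators decide. Thus every prime filter of `L^{◇□}` is pulled back along `ε` from a point. -/
theorem mem_iff_toConvexClosed_mem (F : PrimeFilter (FreeDiaBox L)) (s : FreeDiaBox L) :
    s ∈ F ↔ toConvexClosed F ∈ epsilonHom L s := by
  obtain ⟨s⟩ := s
  change FreeDiaBox.mk s ∈ F ↔ toConvexClosed F ∈ epsilonHom L (FreeDiaBox.mk s)
  induction s with
  | box a => exact box_mem_iff_forall.trans mem_hitMiss_box.symm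
  | dia a => exact dia_mem_iff_exists
  | top => exact iff_of_true F.top_mem trivial
  | bot => exact iff_of_false F.bot_notMem id
  | inf s t hs ht => exact F.inf_mem_iff.trans (and_congr hs ht)
  | sup s t hs ht => exact F.sup_mem_iff.trans (or_congr hs ht)

/-- If `s ≰ t`, a prime filter contains `s` and omits `t`; its convex closed set lies in `ε(s)` but
not in `ε(t)`. -/
theorem epsilonHom_injective : Function.Injective (epsilonHom L) := by
  have h : ∀ s t, epsilonHom L s = epsilonHom L t → s ≤ t := by
    intro s t hst
    by_contra hle
    obtain ⟨F, hs, ht⟩ := exists_mem_notMem hle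
    rw [mem_iff_toConvexClosed_mem] at hs ht
    exact ht (hst ▸ hs)
  exact fun s t hst => le_antisymm (h s t hst) (h t s hst.symm)

end Epsilon

/-! ### Naturality and the derived isomorphisms -/

section NaturalIsomorphisms

/-- The component at `L` of the natural isomorphism `K ≅ CU ∘ C ∘ P`. -/
def epsilonApp (L : BddDistLat.{u}) :
    K.obj L ⟶ (P.rightOp ⋙ C.op ⋙ CU).obj L :=
  BddDistLat.ofHom (epsilonHom L)

instance isIso_epsilonApp (L : BddDistLat.{u}) : IsIso (epsilonApp L) :=
  let e := Equiv.ofBijective (epsilonHom L) ⟨epsilonHom_injective, epsilonHom_surjective⟩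
  (BddDistLat.Iso.mk (α := K.obj L) (β := (P.rightOp ⋙ C.op ⋙ CU).obj L)
    (e.toOrderIso (OrderHomClass.mono (epsilonHom L)) fun A B hAB => by
    -- Written as a meet equation, the order is reflected by any injective meet-preserving map.
    rw [← inf_eq_left]
    refine epsilonHom_injective ((map_inf (epsilonHom L) _ _).trans ?_)
    have h : ∀ A, epsilonHom L (e.symm A) = A := e.apply_symm_apply
    rw [h, h, inf_eq_left]
    exact hAB)).isIso_hom

/-- On generators this holds because passing to the convex hull `↓f(A) ∩ ↑f(A)` does not change
which upsets or downsets are hit. -/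
theorem epsilonApp_naturality {L M : BddDistLat.{u}} (f : L ⟶ M) :
    K.map f ≫ epsilonApp M = epsilonApp L ≫ (P.rightOp ⋙ C.op ⋙ CU).map f := by
  refine BddDistLat.hom_ext (FreeDiaBox.hom_ext (fun a => ?_) fun a => ?_)
  · exact SetLike.coe_injective (A := ClopenUpperSet (ConvexClosed (PrimeFilter M)))
      (ConvexClosed.mapFun_preimage_miss (PrimeFilter.comap f.hom)
        (Or.inr (PrimeFilter.isUpperSet_plus a).compl)).symm
  · exact SetLike.coe_injective (A := ClopenUpperSet (ConvexClosed (PrimeFilter M)))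
      (ConvexClosed.mapFun_preimage_hit (PrimeFilter.comap f.hom)
        (Or.inl (PrimeFilter.isUpperSet_plus a))).symm

/-- The natural isomorphism `K ≅ CU ∘ C ∘ P` with `□_a ↦ □_{a⁻}` and `◇_a ↦ ◇_{a⁺}`. -/
noncomputable def epsilon : K.{u} ≅ P.rightOp ⋙ C.op ⋙ CU :=
  NatIso.ofComponents (fun L => asIso (epsilonApp L)) epsilonApp_naturality

/-- The natural isomorphism `C ∘ P ≅ P ∘ K`. -/
noncomputable def vietorisPrimeIso : P ⋙ C.{u} ≅ K.{u}.op ⋙ P :=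
  NatIso.ofComponents
    (fun L => etaIso (C.obj (P.obj L)) ≪≫ P.mapIso (asIso (epsilonApp L.unop)).op)
    (fun {L M} f => by
      simp only [Iso.trans_hom, etaIso, asIso_hom, Functor.mapIso_hom, Iso.op_hom, Functor.comp_map,
        Functor.op_map, Category.assoc]
      rw [← Category.assoc]
      -- Naturality of `η` at `C(P(f))` leaves `P` applied to the naturality square of `ε`.
      refine (congrArg (· ≫ P.map (epsilonApp M.unop).op)
        (eta_naturality (C.map (P.map f)))).trans ((Category.assoc _ _ _).trans ?_)
      rw [← P.map_comp, ← P.map_comp]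
      exact congrArg (fun g => eta (C.obj (P.obj L)) ≫ P.map g)
        (congrArg Quiver.Hom.op (epsilonApp_naturality f.unop)).symm)

/-- The natural isomorphism `K ∘ CU ≅ CU ∘ C`. -/
noncomputable def clopenVietorisIso : CU ⋙ K.{u} ≅ C.op ⋙ CU :=
  NatIso.ofComponents
    (fun X => asIso (epsilonApp (CU.obj X)) ≪≫ CU.mapIso (C.mapIso (etaIso X.unop)).op)
    (fun {X Y} f => by
      simp only [Iso.trans_hom, etaIso, asIso_hom, Functor.mapIso_hom, Iso.op_hom, Functor.comp_map,
        Functor.op_map, Category.assoc]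
      rw [← Category.assoc, epsilonApp_naturality, Category.assoc]
      refine congrArg (epsilonApp (CU.obj X) ≫ ·) ?_
      simp only [Functor.comp_map, ← Functor.map_comp, Functor.op_map, ← op_comp]
      -- With `ε` moved across, what remains is `CU ∘ C` applied to the naturality square of `η`.
      exact congrArg (fun g => CU.map (C.map g).op) (eta_naturality f.unop).symm)

end NaturalIsomorphisms

end PriestleyDuality

theorem mainTheorem2 :
    ∃ (ε : PriestleyDuality.K.{u} ≅
          PriestleyDuality.P.rightOp ⋙ PriestleyDuality.C.op ⋙ PriestleyDuality.CU)
      (ψ : PriestleyDuality.K.{u}.op ⋙ PriestleyDuality.P ≅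
          PriestleyDuality.P ⋙ PriestleyDuality.C)
      (φ : PriestleyDuality.CU ⋙ PriestleyDuality.K.{u} ≅
          PriestleyDuality.C.op ⋙ PriestleyDuality.CU),
      (∀ (L : BddDistLat.{u}) (a : L),
        SetLike.coe
            (A := ClopenUpperSet (PriestleyDuality.ConvexClosed (PriestleyDuality.PrimeFilter L)))
            (ε.hom.app L (PriestleyDuality.box a)) =
          PriestleyDuality.ConvexClosed.miss (PriestleyDuality.PrimeFilter.minus a)) ∧
      (∀ (L : BddDistLat.{u}) (a : L),
        SetLike.coe
            (A := ClopenUpperSet (PriestleyDuality.ConvexClosed (PriestleyDuality.PrimeFilter L)))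
            (ε.hom.app L (PriestleyDuality.dia a)) =
          PriestleyDuality.ConvexClosed.hit (PriestleyDuality.PrimeFilter.plus a)) ∧
      (∀ L : BddDistLat.{u},
        ψ.inv.app (Opposite.op L) =
          PriestleyDuality.eta
              (PriestleyDuality.C.obj (PriestleyDuality.P.obj (Opposite.op L))) ≫
            PriestleyDuality.P.map (ε.hom.app L).op) ∧
      (∀ X : PriestleyDuality.PS.{u},
        φ.hom.app (Opposite.op X) =
          ε.hom.app (PriestleyDuality.CU.obj (Opposite.op X)) ≫
            PriestleyDuality.CU.map (PriestleyDuality.C.map (PriestleyDuality.eta X)).op) := by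
  -- The formula prescribes `ψ⁻¹`, the direction in which `η` maps, so `ψ` is the inverse of the
  -- isomorphism built from it.
  exact ⟨PriestleyDuality.epsilon, PriestleyDuality.vietorisPrimeIso.symm,
    PriestleyDuality.clopenVietorisIso, fun _ _ => rfl, fun _ _ => rfl, fun _ => rfl, fun _ => rfl⟩
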